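/- Let $H$ be a real Hilbert space, let $A,B:H\to 2^H$ be maximally monotone, and let $C:H\to H$ be $\beta$-cocoercive for some $\beta>0$, i.e. $\langle x-y,Cx-Cy\rangle\ge\beta\|Cx-Cy\|^2$ for all $x,y\in H$. For a set-valued operator $M$ on $H$ write $\operatorname{dom}M=\{x: Mx\neq\varnothing\}$, $\operatorname{zer}M=\{x: 0\in Mx\}$ and $J_{\gamma M}=(I+\gamma M)^{-1}$. Assume $\operatorname{zer}(A+B+C)\neq\varnothing$. For $\gamma>0$ let $$T:=I-J_{\gamma B}+J_{\gamma A}\circ(2J_{\gamma B}-I-\gamma\, C\circ J_{\gamma B}).$$ Given $z^{0},z^{-1}\in H$, let for $k=0,1,2,\dots$ $$y^k=z^k+\alpha_k(z^k-z^{k-1}),\qquad x_B^k=J_{\gamma B}y^k,\qquad x_A^k=J_{\gamma A}(2x_B^k-y^k-\gamma Cx_B^k),\qquad z^{k+1}=y^k+\lambda_k(x_A^k-x_B^k).$$ Assume that (i1) $\gamma\in(0,2\beta\overline{\varepsilon})$ for some $\overline{\varepsilon}\in(0,1)$; (i2) $(\alpha_k)_{k\ge1}$ is nondecreasing, $\alpha_1=0$,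 and $0\le\alpha_k\le\alpha<1$ for all $k\ge1$; (i3) there are $\lambda,\sigma,\delta>0$ with $$\delta>\frac{\alpha^2(1+\alpha)+\alpha\sigma}{1-\alpha^2}\quad\text{and}\quad 0<\lambda\le\lambda_k\le\frac{\delta-\alpha[\alpha(1+\alpha)+\alpha\delta+\sigma]}{\overline{\alpha}\,\delta\,[1+\alpha(1+\alpha)+\alpha\delta+\sigma]}\quad\text{for all }k\ge1,$$ where $\overline{\alpha}=\frac{1}{2-\overline{\varepsilon}}$. Then $J_{\gamma B}w\in\operatorname{zer}(A+B+C)$ for every fixed point $w$ of $T$, and the following hold. (i) $(z^k)$ converges weakly to a fixed point $z^*$ of $T$. (ii) $(x_B^k)$ converges weakly to $J_{\gamma B}z^*\in\operatorname{zer}(A+B+C)$, with $z^*$ the weak limit in (i). (iii) $(x_A^k)$ converges weakly to $J_{\gamma B}z^*$. (iv) $(x_A^k)$ and $(x_B^k)$ converge strongly to $J_{\gamma B}z^*$ if one of the following holds: (a) $A$ is uniformly monotone on every nonempty bounded subset of $\operatorname{dom}A$; (b) $B$ is uniformly monotone on every nonempty bounded subset of $\operatorname{dom}B$; (c) $C$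 is demiregular at every $x\in\operatorname{zer}(A+B+C)$. In cases (a) and (b), $(x_A^k)$ and $(x_B^k)$ converge strongly to $J_{\gamma B}w$ for every fixed point $w$ of $T$. Here $M$ is uniformly monotone on a set $S$ if there is an increasing (not necessarily strictly) function $\psi:[0,+\infty)\to[0,+\infty]$ vanishing only at $0$ with $\langle x-y,u-v\rangle\ge\psi(\|x-y\|)$ for all $x,y\in S$, $u\in Mx$, $v\in My$; and $C$ is demiregular at $x$ if $x^k\rightharpoonup x$ and $Cx^k\to Cx$ imply $x^k\to x$ for all sequences $(x^k)$ in $H$. -/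

import Mathlib

open Filter Topology
open scoped Pointwise NNReal ENNReal

/-! Set-valued operators on a real Hilbert space `H` are functions `H → Set H`; the order on them
is inclusion of graphs and their sum is the pointwise Minkowski sum. -/

namespace SetOp

variable {H : Type*} [NormedAddCommGroup H] [InnerProductSpace ℝ H]

/-- The domain of a set-valued operator. -/
def dom (A : H → Set H) : Set H := {x | (A x).Nonempty}

/-- The zeros of a set-valued operator. -/
def zer (A : H → Set H) : Set H := {x | (0 : H) ∈ A x}

/-- The inverse of a set-valued operator. -/
def inv (A : H → Set H) : H → Set H := fun u => {x | u ∈ A x}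

/-- A single-valued operator seen as a set-valued one. -/
def ofFun (C : H → H) : H → Set H := fun x => {C x}

/-- Monotone set-valued operators. -/
def IsMonotone (A : H → Set H) : Prop :=
  ∀ x y u v : H, u ∈ A x → v ∈ A y → 0 ≤ inner ℝ (x - y) (u - v)

/-- Maximally monotone operators: monotone, with a graph that is not strictly contained in the
graph of another monotone operator. -/
def IsMaximallyMonotone (A : H → Set H) : Prop := Maximal IsMonotone A

/-- `A` is uniformly monotone on the set `S`: there is an increasing (in the wide sense) modulus
`ψ : [0, ∞) → [0, ∞]`, vanishing only at `0`, with `⟪x - y, u - v⟫ ≥ ψ ‖x - y‖` for all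
`x, y ∈ S`, `u ∈ A x`, `v ∈ A y`. -/
def IsUniformlyMonotoneOn (A : H → Set H) (S : Set H) : Prop :=
  ∃ ψ : ℝ≥0 → ℝ≥0∞, Monotone ψ ∧ (∀ t, ψ t = 0 ↔ t = 0) ∧
    ∀ x ∈ S, ∀ y ∈ S, ∀ u ∈ A x, ∀ v ∈ A y,
      ((ψ ‖x - y‖₊ : ℝ≥0∞) : EReal) ≤ ((inner ℝ (x - y) (u - v) : ℝ) : EReal)

/-- `A` is uniformly monotone on every nonempty bounded subset of its domain. -/
def IsUniformlyMonotoneOnBounded (A : H → Set H) : Prop :=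
  ∀ S : Set H, S ⊆ dom A → S.Nonempty → Bornology.IsBounded S → IsUniformlyMonotoneOn A S

/-- Weak convergence of a sequence. -/
def WeakTendsto (x : ℕ → H) (a : H) : Prop :=
  Tendsto (fun k => toWeakSpace ℝ H (x k)) atTop (𝓝 (toWeakSpace ℝ H a))

/-- `A` is demiregular at the point `x` of its domain. -/
def IsDemiregularAt (A : H → Set H) (x : H) : Prop :=
  x ∈ dom A ∧ ∀ u ∈ A x, ∀ xs us : ℕ → H, (∀ k, us k ∈ A (xs k)) →
    WeakTendsto xs x → Tendsto us atTop (𝓝 u) → Tendsto xs atTop (𝓝 x)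

/-- `C` is `β`-cocoercive. -/
def IsCocoercive (β : ℝ) (C : H → H) : Prop :=
  ∀ x y : H, β * ‖C x - C y‖ ^ 2 ≤ inner ℝ (x - y) (C x - C y)

/-- The set-valued resolvent `(I + γ A)⁻¹`. -/
def resolventSet (γ : ℝ) (A : H → Set H) : H → Set H := inv (ofFun id + γ • A)

/-- The resolvent `J_{γA} = (I + γ A)⁻¹` as a map `H → H`: for `A` maximally monotone on a Hilbert
space and `γ > 0`, `resolventSet γ A x` is a singleton and `resolventMap γ A x` is its element. -/
noncomputable def resolventMap (γ : ℝ) (A : H → Set H) (x : H) : H :=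
  Classical.epsilon fun p => p ∈ resolventSet γ A x

theorem mem_resolventSet {γ : ℝ} {A : H → Set H} {x p : H} :
    p ∈ resolventSet γ A x ↔ ∃ u ∈ A p, p + γ • u = x := by
  simp only [resolventSet, inv, ofFun, Set.mem_ofPred_eq, Pi.add_apply, Pi.smul_apply, id_eq,
    Set.mem_add, Set.mem_singleton_iff, Set.mem_smul_set]
  constructor
  · rintro ⟨_, rfl, _, ⟨u, hu, rfl⟩, h⟩
    exact ⟨u, hu, h⟩
  · rintro ⟨u, hu, h⟩
    exact ⟨p, rfl, _, ⟨u, hu, rfl⟩, h⟩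

/-- The resolvent is characterised by its defining inclusion as soon as `A` is monotone. -/
theorem resolvent_eq_of_mem {γ : ℝ} (hγ : 0 < γ) {A : H → Set H} (hA : IsMonotone A) {x p : H}
    (hp : p ∈ resolventSet γ A x) : resolventMap γ A x = p := by
  have hq : resolventMap γ A x ∈ resolventSet γ A x := Classical.epsilon_spec ⟨p, hp⟩
  obtain ⟨u, hu, hux⟩ := mem_resolventSet.1 hq
  obtain ⟨v, hv, hvx⟩ := mem_resolventSet.1 hp
  have h := hA _ _ _ _ hu hv
  have hd : resolventMap γ A x - p = -(γ • (u - v)) := by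
    rw [smul_sub, eq_neg_iff_add_eq_zero]
    have := hux.trans hvx.symm
    rw [← sub_eq_zero] at this
    rw [← this]; abel
  have h2 : u - v = 0 := by
    rw [hd, inner_neg_left, real_inner_smul_left, real_inner_self_eq_norm_sq] at h
    have : ‖u - v‖ ^ 2 ≤ 0 := by nlinarith [sq_nonneg ‖u - v‖]
    exact norm_eq_zero.1 (pow_eq_zero_iff (two_ne_zero)|>.1 (le_antisymm this (sq_nonneg _)))
  rw [h2, smul_zero, neg_zero, sub_eq_zero] at hd
  exact hd

/-- The Davis–Yin operator `T = I - J_{γB} + J_{γA} (2 J_{γB} - I - γ C J_{γB})`. -/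
noncomputable def davisYin (γ : ℝ) (A B : H → Set H) (C : H → H) (x : H) : H :=
  x - resolventMap γ B x
    + resolventMap γ A ((2 : ℝ) • resolventMap γ B x - x - γ • C (resolventMap γ B x))

/-- The sequences `z, y, xB, xA` are generated by the inertial three-operator splitting algorithm
from the starting points `z 0` and `zpre` (the latter plays the role of `z^{-1}`), with inertial
parameters `α k` and relaxation parameters `lam k`. -/
structure IsInertialSplitting (γ : ℝ) (A B : H → Set H) (C : H → H) (α lam : ℕ → ℝ)
    (zpre : H) (z y xB xA : ℕ → H) : Prop where
  y_zero : y 0 = z 0 + α 0 • (z 0 - zpre)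
  y_succ : ∀ k, y (k + 1) = z (k + 1) + α (k + 1) • (z (k + 1) - z k)
  xB_eq : ∀ k, xB k = resolventMap γ B (y k)
  xA_eq : ∀ k, xA k = resolventMap γ A ((2 : ℝ) • xB k - y k - γ • C (xB k))
  z_succ : ∀ k, z (k + 1) = y k + lam k • (xA k - xB k)

end SetOp

open SetOp

/-!
The argument compares the iteration with an arbitrary fixed point `w` of the Davis–Yin operator.

Maximal monotonicity enters through Minty's theorem: `I + γA` is onto, so that the resolvents are
characterised by their inclusions. It is obtained in `exists_rel_neg_of_maximal` by minimising the
Fitzpatrick function plus half the squared norm over `H × H`. A minimising sequence of this strongly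
convex functional is Cauchy, so neither weak compactness nor a separation theorem is needed.

For a point `y` let `d = x_A - x_B` be its residual. `gap_identity` writes the sum of the
monotonicity gaps of `A`, `B` and `C` between `y` and `w`, all of them nonnegative, in terms of `d`.
This is used twice. With cocoercivity it gives `(1 - ε/2) ‖d‖² ≤ -⟪d, y - w⟫`, whence the Fejér
inequality `relaxed_step_fejer` for the relaxed step. And as soon as `d → 0` along a bounded
sequence it forces every single gap to `0` (`gaps_tendsto_zero`): the values `C x_B` converge
strongly to `C (J_{γB} w)`, and uniform monotonicity of `A` or `B` makes `x_A` and `x_B` converge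
strongly to `J_{γB} w`.

The inertial terms are absorbed by the Lyapunov function
`‖z (k + 1) - w‖² - a k ‖z k - w‖² + G ‖z (k + 1) - z k‖²`, with `a k` the inertial parameter of
the step from `z k` and `z (k + 1)` and `G` a constant. The bound on the relaxation parameters is
what makes it decrease by at least `σ ‖z (k + 2) - z (k + 1)‖²` (`inertial_step`). So the increments
of `z` vanish, hence also the residuals, and `‖z k - w‖` converges for every fixed point `w`
(`inertial_fejer_convergence`).

Weak cluster points are taken along ultrafilters, which replaces the extraction of subsequences.
Since `C x_B` converges strongly, the elements selected from `A` and `B` have a strongly convergent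
sum, and monotonicity of `A × B` passes to the limit (`mem_and_mem_of_weak_limits`). Every weak
cluster point `a` of `z` is thus a fixed point, and `x_B` converges weakly to `J_{γB} a` along the
same ultrafilter (`isFixedPt_of_weak_limit`). `opial` then gives a single weak limit.
-/

/-! ### Weak convergence -/

/-- Weak convergence in a Hilbert space is tested against the vectors of the space, by the Riesz
representation theorem. -/
theorem weakTendsto_iff_forall_inner {H : Type*} [NormedAddCommGroup H] [InnerProductSpace ℝ H]
    [CompleteSpace H] {x : ℕ → H} {a : H} :
    WeakTendsto x a ↔ ∀ v : H, Tendsto (fun k => inner ℝ v (x k)) atTop (𝓝 (inner ℝ v a)) := by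
  have hinj : Function.Injective (topDualPairing ℝ H).flip := by
    intro u v huv
    refine ext_inner_left ℝ fun w => ?_
    exact DFunLike.congr_fun huv (InnerProductSpace.toDual ℝ H w)
  refine (WeakBilin.tendsto_iff_forall_eval_tendsto (topDualPairing ℝ H).flip hinj).trans ?_
  constructor
  · intro h v
    exact h (InnerProductSpace.toDual ℝ H v)
  · intro h f
    obtain ⟨v, rfl⟩ := (InnerProductSpace.toDual ℝ H).surjective f
    exact h v

/-- Weak sequential compactness in terms of ultrafilters: along an ultrafilter every bounded
sequence has a weak limit. -/
theorem exists_weak_limit_of_bounded {H : Type*} [NormedAddCommGroup H] [InnerProductSpace ℝ H]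
    [CompleteSpace H] (U : Ultrafilter ℕ) {x : ℕ → H} {M : ℝ} (hx : ∀ k, ‖x k‖ ≤ M) :
    ∃ a : H, ∀ v : H, Tendsto (fun k => inner ℝ v (x k)) U (𝓝 (inner ℝ v a)) := by
  have hb : ∀ v k, |inner ℝ v (x k)| ≤ M * ‖v‖ := fun v k =>
    (abs_real_inner_le_norm v (x k)).trans (by nlinarith [norm_nonneg v, hx k])
  have hlim : ∀ v : H, ∃ l : ℝ, |l| ≤ M * ‖v‖ ∧ Tendsto (fun k => inner ℝ v (x k)) U (𝓝 l) := by
    intro v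
    obtain ⟨l, hl, hle⟩ := (isCompact_Icc (a := -(M * ‖v‖)) (b := M * ‖v‖)).ultrafilter_le_nhds
      (U.map fun k => inner ℝ v (x k)) (by
        rw [le_principal_iff]
        exact Filter.mem_map.2 (Filter.univ_mem' fun k => abs_le.1 (hb v k)))
    exact ⟨l, abs_le.2 hl, hle⟩
  choose l hlM hl using hlim
  let L : H →ₗ[ℝ] ℝ :=
    { toFun := l
      map_add' := fun u v => tendsto_nhds_unique (hl (u + v)) <| by
        simpa only [inner_add_left] using (hl u).add (hl v)
      map_smul' := fun c v => tendsto_nhds_unique (hl (c • v)) <| by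
        simpa only [real_inner_smul_left, RingHom.id_apply, smul_eq_mul] using
          (hl v).const_mul c }
  let F : StrongDual ℝ H := L.mkContinuous M hlM
  refine ⟨(InnerProductSpace.toDual ℝ H).symm F, fun v => ?_⟩
  rw [real_inner_comm, InnerProductSpace.toDual_symm_apply]
  exact hl v

/-- The inner product of a strongly convergent and a weakly convergent bounded sequence. -/
theorem tendsto_inner_of_strong_weak {H : Type*} [NormedAddCommGroup H] [InnerProductSpace ℝ H]
    {l : Filter ℕ} {u x : ℕ → H} {b a : H} {M : ℝ} (hx : ∀ k, ‖x k‖ ≤ M)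
    (hu : Tendsto u l (𝓝 b))
    (hxa : ∀ v : H, Tendsto (fun k => inner ℝ v (x k)) l (𝓝 (inner ℝ v a))) :
    Tendsto (fun k => inner ℝ (u k) (x k)) l (𝓝 (inner ℝ b a)) := by
  have h0 : Tendsto (fun k => inner ℝ (u k - b) (x k)) l (𝓝 0) := by
    have hn : Tendsto (fun k => ‖u k - b‖ * M) l (𝓝 0) := by
      simpa using (tendsto_iff_norm_sub_tendsto_zero.1 hu).mul_const M
    refine squeeze_zero_norm (fun k => ?_) hn
    exact (norm_inner_le_norm _ _).trans (mul_le_mul_of_nonneg_left (hx k) (norm_nonneg _))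
  have h1 := h0.add (hxa b)
  simpa only [inner_sub_left, sub_add_cancel, zero_add] using h1

/-! ### Surjectivity of `I + γA` -/

/-- A functional `(x, t) ↦ t + ‖x‖² / 2` that is bounded below on a nonempty closed convex set has
a minimiser there; the conclusion is the variational inequality at that minimiser. -/
theorem exists_variational_ineq {E : Type*} [NormedAddCommGroup E] [InnerProductSpace ℝ E]
    [CompleteSpace E] {K : Set (E × ℝ)} (hconv : Convex ℝ K) (hcl : IsClosed K)
    (hne : K.Nonempty) {m₀ : ℝ} (hbd : ∀ q ∈ K, m₀ ≤ q.2 + ‖q.1‖ ^ 2 / 2) :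
    ∃ p ∈ K, ∀ q ∈ K, p.2 + ‖p.1‖ ^ 2 ≤ q.2 + inner ℝ p.1 q.1 := by
  set f : E × ℝ → ℝ := fun q => q.2 + ‖q.1‖ ^ 2 / 2 with hf
  have hbdd : BddBelow (f '' K) := ⟨m₀, by rintro _ ⟨q, hq, rfl⟩; exact hbd q hq⟩
  set m := sInf (f '' K) with hm
  have hmle : ∀ q ∈ K, m ≤ f q := fun q hq => csInf_le hbdd ⟨q, hq, rfl⟩
  have hseq : ∀ n : ℕ, ∃ q ∈ K, f q < m + 1 / ((n : ℝ) + 1) := by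
    intro n
    have hpos : (0 : ℝ) < 1 / ((n : ℝ) + 1) := by positivity
    obtain ⟨_, ⟨q, hq, rfl⟩, hlt⟩ := exists_lt_of_csInf_lt (hne.image f)
      (show sInf (f '' K) < m + 1 / ((n : ℝ) + 1) by linarith)
    exact ⟨q, hq, hlt⟩
  choose q hqK hqlt using hseq
  -- the parallelogram identity at the midpoint makes a minimising sequence Cauchy
  have hmid : ∀ n k, ‖(q n).1 - (q k).1‖ ^ 2 ≤ 4 * (1 / ((n : ℝ) + 1) + 1 / ((k : ℝ) + 1)) := by
    intro n k
    have hK : (1 / 2 : ℝ) • q n + (1 / 2 : ℝ) • q k ∈ K :=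
      hconv (hqK n) (hqK k) (by norm_num) (by norm_num) (by norm_num)
    have h1 := hmle _ hK
    have h2 : ‖(1 / 2 : ℝ) • (q n).1 + (1 / 2 : ℝ) • (q k).1‖ ^ 2
        = ‖(q n).1‖ ^ 2 / 2 + ‖(q k).1‖ ^ 2 / 2 - ‖(q n).1 - (q k).1‖ ^ 2 / 4 := by
      rw [norm_add_sq_real, norm_sub_sq_real, norm_smul, norm_smul, real_inner_smul_left,
        real_inner_smul_right]
      norm_num
      ring
    have h3 := hqlt n
    have h4 := hqlt k
    simp only [hf, Prod.fst_add, Prod.snd_add, Prod.smul_fst, Prod.smul_snd, smul_eq_mul, h2]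
      at h1 h3 h4
    linarith
  have hcauchy : CauchySeq fun n => (q n).1 := by
    refine cauchySeq_of_le_tendsto_0 (fun N : ℕ => √(8 * (1 / ((N : ℝ) + 1)))) ?_ ?_
    · intro n k N hn hk
      rw [dist_eq_norm]
      refine Real.le_sqrt_of_sq_le ((hmid n k).trans ?_)
      have h1 := Nat.one_div_le_one_div (α := ℝ) hn
      have h2 := Nat.one_div_le_one_div (α := ℝ) hk
      linarith
    · have h := (tendsto_one_div_add_atTop_nhds_zero_nat (𝕜 := ℝ)).const_mul 8
      have h' := (Real.continuous_sqrt.tendsto _).comp h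
      rwa [mul_zero, Real.sqrt_zero] at h'
  obtain ⟨x, hx⟩ := cauchySeq_tendsto_of_complete hcauchy
  have hfm : Tendsto (fun n => f (q n)) atTop (𝓝 m) := by
    have h := (tendsto_one_div_add_atTop_nhds_zero_nat (𝕜 := ℝ)).const_add m
    rw [add_zero] at h
    exact tendsto_of_tendsto_of_tendsto_of_le_of_le tendsto_const_nhds h
      (fun n => hmle _ (hqK n)) (fun n => (hqlt n).le)
  have ht : Tendsto (fun n => (q n).2) atTop (𝓝 (m - ‖x‖ ^ 2 / 2)) := by
    have h := hfm.sub ((hx.norm.pow 2).div_const 2)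
    simpa [hf] using h
  have hpK : (x, m - ‖x‖ ^ 2 / 2) ∈ K :=
    hcl.mem_of_tendsto (hx.prodMk_nhds ht) (Eventually.of_forall hqK)
  refine ⟨_, hpK, fun r hr => ?_⟩
  -- compare with the points `p + s (r - p)` for small `s > 0`
  have hs : ∀ s ∈ Set.Ioc (0 : ℝ) 1,
      0 ≤ (r.2 - (m - ‖x‖ ^ 2 / 2) + inner ℝ x (r.1 - x)) + s * (‖r.1 - x‖ ^ 2 / 2) := by
    intro s hs
    have h1 := hmle _ (hconv.add_smul_sub_mem hpK hr ⟨hs.1.le, hs.2⟩)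
    simp only [hf, Prod.fst_add, Prod.snd_add, Prod.smul_fst, Prod.smul_snd, Prod.fst_sub,
      Prod.snd_sub, smul_eq_mul, norm_add_sq_real, real_inner_smul_right, norm_smul,
      Real.norm_eq_abs, mul_pow, sq_abs] at h1
    refine nonneg_of_mul_nonneg_right (a := s) ?_ hs.1
    nlinarith
  have hlim : Tendsto (fun s : ℝ => (r.2 - (m - ‖x‖ ^ 2 / 2) + inner ℝ x (r.1 - x))
      + s * (‖r.1 - x‖ ^ 2 / 2)) (𝓝[>] 0) (𝓝 (r.2 - (m - ‖x‖ ^ 2 / 2) + inner ℝ x (r.1 - x))) := by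
    refine Tendsto.mono_left ?_ nhdsWithin_le_nhds
    have hc : Continuous fun s : ℝ => (r.2 - (m - ‖x‖ ^ 2 / 2) + inner ℝ x (r.1 - x))
      + s * (‖r.1 - x‖ ^ 2 / 2) := by fun_prop
    simpa using hc.tendsto 0
  have h0 := ge_of_tendsto hlim
    (Filter.mem_of_superset (Ioc_mem_nhdsGT (zero_lt_one' ℝ)) fun s h => hs s h)
  rw [inner_sub_right, real_inner_self_eq_norm_sq] at h0
  dsimp only
  linarith

/-- Minty's theorem for a maximal monotone relation `G`: some `x` satisfies `G x (-x)`. The point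
comes from minimising `F + ‖·‖² / 2` over `H × H`, where
`F (x, u) = sup {⟪x, b⟫ + ⟪a, u⟫ - ⟪a, b⟫ | G a b}` is the Fitzpatrick function of `G`; by
maximality `F (x, u) ≥ ⟪x, u⟫`. -/
theorem exists_rel_neg_of_maximal {H : Type*} [NormedAddCommGroup H] [InnerProductSpace ℝ H]
    [CompleteSpace H] {G : H → H → Prop}
    (hmono : ∀ x y u v, G x u → G y v → 0 ≤ inner ℝ (x - y) (u - v))
    (hmax : ∀ x u, (∀ a b, G a b → 0 ≤ inner ℝ (x - a) (u - b)) → G x u) :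
    ∃ x, G x (-x) := by
  have hG : ∃ a b, G a b := by
    by_contra! h
    exact h 0 0 (hmax 0 0 fun a b hab => absurd hab (h a b))
  -- the epigraph of the Fitzpatrick function
  let K : Set (WithLp 2 (H × H) × ℝ) :=
    {q | ∀ a b, G a b → inner ℝ q.1.fst b + inner ℝ a q.1.snd - inner ℝ a b ≤ q.2}
  have hKle : ∀ q ∈ K, inner ℝ q.1.fst q.1.snd ≤ q.2 := by
    intro q hq
    by_contra! hlt
    have hmem : G q.1.fst q.1.snd := hmax _ _ fun a b hab => by
      have := hq a b hab
      rw [inner_sub_left, inner_sub_right, inner_sub_right]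
      linarith
    have := hq _ _ hmem
    linarith
  have hconv : Convex ℝ K := by
    intro p hp q hq s t hs ht hst a b hab
    have h1 := mul_le_mul_of_nonneg_left (hp a b hab) hs
    have h2 := mul_le_mul_of_nonneg_left (hq a b hab) ht
    simp only [Prod.fst_add, Prod.snd_add, Prod.smul_fst, Prod.smul_snd, WithLp.add_fst,
      WithLp.add_snd, WithLp.smul_fst, WithLp.smul_snd, smul_eq_mul, inner_add_left,
      inner_add_right, real_inner_smul_left, real_inner_smul_right]
    have h3 : inner ℝ a b = s * inner ℝ a b + t * inner ℝ a b := by rw [← add_mul, hst, one_mul]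
    linarith
  have hcl : IsClosed K := by
    simp only [K, Set.ofPred_forall]
    refine isClosed_iInter fun a => isClosed_iInter fun b => isClosed_iInter fun _ => ?_
    refine isClosed_le ?_ continuous_snd
    have h1 : Continuous fun q : WithLp 2 (H × H) × ℝ => q.1.fst :=
      (WithLp.prod_continuous_ofLp 2 H H).fst.comp continuous_fst
    have h2 : Continuous fun q : WithLp 2 (H × H) × ℝ => q.1.snd :=
      (WithLp.prod_continuous_ofLp 2 H H).snd.comp continuous_fst
    exact ((h1.inner continuous_const).add (continuous_const.inner h2)).sub continuous_const
  have hmem : ∀ a b, G a b → ((WithLp.toLp 2 (a, b), inner ℝ a b) : WithLp 2 (H × H) × ℝ) ∈ K := by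
    intro a b hab c d hcd
    have := hmono _ _ _ _ hab hcd
    rw [inner_sub_left, inner_sub_right, inner_sub_right] at this
    simp only [WithLp.toLp_fst, WithLp.toLp_snd]
    linarith
  have hbd : ∀ q ∈ K, (0 : ℝ) ≤ q.2 + ‖q.1‖ ^ 2 / 2 := by
    intro q hq
    have h1 := hKle q hq
    have h2 := norm_add_sq_real q.1.fst q.1.snd
    have h3 := sq_nonneg ‖q.1.fst + q.1.snd‖
    rw [WithLp.prod_norm_sq_eq_of_L2]
    linarith
  obtain ⟨a₀, b₀, hab₀⟩ := hG
  obtain ⟨p, hp, hpv⟩ := exists_variational_ineq hconv hcl ⟨_, hmem a₀ b₀ hab₀⟩ hbd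
  set x := p.1.fst
  set u := p.1.snd
  have hsq : ∀ a b, G a b → ‖x + u‖ ^ 2 ≤ inner ℝ (-u - a) (-x - b) := by
    intro a b hab
    have h1 := hpv _ (hmem a b hab)
    have h2 := hKle p hp
    rw [WithLp.prod_norm_sq_eq_of_L2, WithLp.prod_inner_apply] at h1
    have h3 : inner ℝ (-u - a) (-x - b)
        = inner ℝ x u + inner ℝ u b + inner ℝ x a + inner ℝ a b := by
      simp only [inner_sub_left, inner_sub_right, inner_neg_left, inner_neg_right,
        real_inner_comm x a, real_inner_comm x u]
      ring
    rw [norm_add_sq_real, h3]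
    change p.2 + (‖x‖ ^ 2 + ‖u‖ ^ 2) ≤ inner ℝ a b + (inner ℝ x a + inner ℝ u b) at h1
    linarith
  have hux : G (-u) (-x) := hmax _ _ fun a b hab => (sq_nonneg _).trans (hsq a b hab)
  have h0 := hsq _ _ hux
  rw [sub_self, inner_zero_left] at h0
  have hxu : x + u = 0 :=
    norm_eq_zero.1 (pow_eq_zero_iff two_ne_zero |>.1 (le_antisymm h0 (sq_nonneg _)))
  rw [← eq_neg_iff_add_eq_zero] at hxu
  exact ⟨x, by rwa [← hxu] at hux⟩

/-- A maximally monotone operator contains every pair that is monotonically related to its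
graph. -/
theorem SetOp.IsMaximallyMonotone.mem_of_forall {H : Type*} [NormedAddCommGroup H]
    [InnerProductSpace ℝ H] {A : H → Set H} (hA : IsMaximallyMonotone A) {x u : H}
    (h : ∀ a b, b ∈ A a → 0 ≤ inner ℝ (x - a) (u - b)) : u ∈ A x := by
  classical
  have hmono : IsMonotone (fun y => A y ∪ {v | y = x ∧ v = u}) := by
    rintro y z v w (hv | ⟨rfl, rfl⟩) (hw | ⟨rfl, rfl⟩)
    · exact hA.1 _ _ _ _ hv hw
    · have := h y v hv
      rwa [← neg_sub y, ← neg_sub v, inner_neg_neg] at this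
    · exact h z w hw
    · simp
  exact hA.2 hmono (fun y => Set.subset_union_left) x (Or.inr ⟨rfl, rfl⟩)

/-- The resolvent of a maximally monotone operator is everywhere defined. -/
theorem SetOp.IsMaximallyMonotone.resolvent_spec {H : Type*} [NormedAddCommGroup H]
    [InnerProductSpace ℝ H] [CompleteSpace H] {A : H → Set H} (hA : IsMaximallyMonotone A)
    {γ : ℝ} (hγ : 0 < γ) (w : H) :
    γ⁻¹ • (w - resolventMap γ A w) ∈ A (resolventMap γ A w) := by
  have hγ0 : γ ≠ 0 := hγ.ne'
  obtain ⟨x, hx⟩ := exists_rel_neg_of_maximal (G := fun a b => γ⁻¹ • b ∈ A (a + w))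
    (fun x y u v hu hv => by
      have h := hA.1 _ _ _ _ hu hv
      rw [add_sub_add_right_eq_sub, ← smul_sub, real_inner_smul_right] at h
      exact nonneg_of_mul_nonneg_right h (inv_pos.2 hγ))
    (fun x u h => hA.mem_of_forall fun a b hab => by
      have h1 := h (a - w) (γ • b) (by simpa [smul_smul, hγ0] using hab)
      have h2 : x + w - a = x - (a - w) := by abel
      have h3 : γ⁻¹ • u - b = γ⁻¹ • (u - γ • b) := by simp [smul_sub, smul_smul, hγ0]
      rw [h2, h3, real_inner_smul_right]
      exact mul_nonneg (inv_pos.2 hγ).le h1)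
  have hJ : resolventMap γ A w = x + w :=
    resolvent_eq_of_mem hγ hA.1 (mem_resolventSet.2 ⟨_, hx, by simp [smul_smul, hγ0]⟩)
  rw [hJ]
  simpa using hx

theorem resolventMap_eq_of_mem {H : Type*} [NormedAddCommGroup H] [InnerProductSpace ℝ H]
    {A : H → Set H} (hA : IsMonotone A) {γ : ℝ} (hγ : 0 < γ) {w p : H}
    (h : γ⁻¹ • (w - p) ∈ A p) : resolventMap γ A w = p :=
  resolvent_eq_of_mem hγ hA (mem_resolventSet.2 ⟨_, h, by simp [smul_smul, hγ.ne']⟩)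

theorem norm_resolventMap_sub_le {H : Type*} [NormedAddCommGroup H] [InnerProductSpace ℝ H]
    [CompleteSpace H] {A : H → Set H} (hA : IsMaximallyMonotone A) {γ : ℝ} (hγ : 0 < γ) (x w : H) :
    ‖resolventMap γ A x - resolventMap γ A w‖ ≤ ‖x - w‖ := by
  have h := hA.1 _ _ _ _ (hA.resolvent_spec hγ x) (hA.resolvent_spec hγ w)
  set p := resolventMap γ A x
  set q := resolventMap γ A w
  rw [← smul_sub, real_inner_smul_right] at h
  have h1 := nonneg_of_mul_nonneg_right h (inv_pos.2 hγ)
  have h2 : (x - p) - (w - q) = (x - w) - (p - q) := by abel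
  rw [h2, inner_sub_right, real_inner_self_eq_norm_sq] at h1
  have h3 := real_inner_le_norm (p - q) (x - w)
  by_contra! hlt
  nlinarith [norm_nonneg (x - w), norm_nonneg (p - q)]

/-! ### Inertial Fejér monotone sequences -/

/-- The squared distance from `w` to the extrapolated point `u + a (u - v)`. -/
theorem norm_extrapolation_sub_sq {H : Type*} [NormedAddCommGroup H] [InnerProductSpace ℝ H]
    (u v w : H) (a : ℝ) :
    ‖u + a • (u - v) - w‖ ^ 2
      = (1 + a) * ‖u - w‖ ^ 2 - a * ‖v - w‖ ^ 2 + a * (1 + a) * ‖u - v‖ ^ 2 := by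
  have h1 : u + a • (u - v) - w = (u - w) + a • ((u - w) - (v - w)) := by
    rw [sub_sub_sub_cancel_right]; abel
  have h2 : u - v = (u - w) - (v - w) := by abel
  rw [h1, h2]
  generalize u - w = p
  generalize v - w = q
  rw [norm_add_sq_real, norm_smul, mul_pow, real_inner_smul_right, inner_sub_right,
    real_inner_self_eq_norm_sq, norm_sub_sq_real, Real.norm_eq_abs, sq_abs]
  ring

/-- One step of an inertial iteration: `u, v` are the last two iterates, `x` is the new one. The
constant `G = amax (1 + amax) + amax δ` bounds the coefficient of `‖u - v‖²` from above, and the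
bound on the relaxation `μ` makes the coefficient of `‖x - u‖²` at most `-(G + σ)`. -/
theorem inertial_step {H : Type*} [NormedAddCommGroup H] [InnerProductSpace ℝ H]
    {u v w x : H} {a amax μ σ δ G : ℝ} (ha : 0 ≤ a) (ha' : a ≤ amax) (hμ : 0 < μ)
    (hσ : 0 < σ) (hδ : 0 < δ) (hG : G = amax * (1 + amax) + amax * δ)
    (hμle : μ * (δ * (1 + (G + σ))) ≤ δ - amax * (G + σ))
    (hfej : ‖x - w‖ ^ 2
      ≤ ‖u + a • (u - v) - w‖ ^ 2 - (1 - μ) / μ * ‖x - (u + a • (u - v))‖ ^ 2) :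
    ‖x - w‖ ^ 2 ≤ (1 + a) * ‖u - w‖ ^ 2 - a * ‖v - w‖ ^ 2 + G * ‖u - v‖ ^ 2
      - (G + σ) * ‖x - u‖ ^ 2 := by
  have hG0 : 0 ≤ G := by
    have := ha.trans ha'
    rw [hG]; positivity
  have hμ1 : μ ≤ 1 := by
    by_contra! h
    have h1 : δ * (1 + (G + σ)) ≤ μ * (δ * (1 + (G + σ))) :=
      le_mul_of_one_le_left (by positivity) h.le
    have h2 : 0 ≤ amax * (G + σ) := mul_nonneg (ha.trans ha') (by positivity)
    have h3 : 0 < δ * (G + σ) := by positivity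
    linarith
  set r := a + δ * μ with hr
  have hr0 : 0 < r := by positivity
  have hnorm : ‖x - (u + a • (u - v))‖ ^ 2
      = ‖x - u‖ ^ 2 - 2 * a * inner ℝ (x - u) (u - v) + a ^ 2 * ‖u - v‖ ^ 2 := by
    rw [← sub_sub, norm_sub_sq_real, norm_smul, mul_pow, real_inner_smul_right, Real.norm_eq_abs,
      sq_abs]
    ring
  -- Young's inequality with weight `r = a + δ μ`
  have hyoung : 2 * inner ℝ (x - u) (u - v) ≤ ‖x - u‖ ^ 2 / r + r * ‖u - v‖ ^ 2 := by
    have h1 := real_inner_le_norm (x - u) (u - v)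
    have h2 : 0 ≤ (‖x - u‖ - r * ‖u - v‖) ^ 2 / r := by positivity
    have h3 : (‖x - u‖ - r * ‖u - v‖) ^ 2 / r
        = ‖x - u‖ ^ 2 / r - 2 * (‖x - u‖ * ‖u - v‖) + r * ‖u - v‖ ^ 2 := by
      field_simp; ring
    linarith
  have hlow : δ * μ / r * ‖x - u‖ ^ 2 - a * (δ * μ) * ‖u - v‖ ^ 2
      ≤ ‖x - (u + a • (u - v))‖ ^ 2 := by
    have h1 := mul_le_mul_of_nonneg_left hyoung ha
    have h2 : δ * μ / r * ‖x - u‖ ^ 2 = ‖x - u‖ ^ 2 - a * (‖x - u‖ ^ 2 / r) := by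
      field_simp; rw [hr]; ring
    have h3 : a * (r * ‖u - v‖ ^ 2) = a ^ 2 * ‖u - v‖ ^ 2 + a * (δ * μ) * ‖u - v‖ ^ 2 := by
      rw [hr]; ring
    rw [hnorm, h2]
    linarith
  have hcoef : G + σ ≤ (1 - μ) * δ / r := by
    rw [le_div_iff₀ hr0, hr]
    have : a * (G + σ) ≤ amax * (G + σ) := mul_le_mul_of_nonneg_right ha' (by positivity)
    linarith
  have hmul := mul_le_mul_of_nonneg_left hlow
    (show 0 ≤ (1 - μ) / μ from div_nonneg (by linarith) hμ.le)
  have heq : (1 - μ) / μ * (δ * μ / r * ‖x - u‖ ^ 2 - a * (δ * μ) * ‖u - v‖ ^ 2)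
      = (1 - μ) * δ / r * ‖x - u‖ ^ 2 - a * δ * (1 - μ) * ‖u - v‖ ^ 2 := by
    field_simp
  rw [heq] at hmul
  have h1 := mul_le_mul_of_nonneg_right hcoef (sq_nonneg ‖x - u‖)
  have hGa : a * (1 + a) + a * δ * (1 - μ) ≤ G := by
    have h2 : a * (1 + a) ≤ amax * (1 + amax) := by
      have := ha.trans ha'
      gcongr
    have h3 : a * δ * (1 - μ) ≤ a * δ := mul_le_of_le_one_right (by positivity) (by linarith)
    have h4 : a * δ ≤ amax * δ := by gcongr
    linarith
  have h2 := mul_le_mul_of_nonneg_right hGa (sq_nonneg ‖u - v‖)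
  rw [norm_extrapolation_sub_sq] at hfej
  linarith

/-- An inertial sequence that is Fejér monotone up to the inertial terms approaches its centre at a
convergent distance, and its increments vanish. The Lyapunov function is
`‖z (k + 1) - w‖² - a k ‖z k - w‖² + G ‖z (k + 1) - z k‖²`. -/
theorem inertial_fejer_convergence {H : Type*} [NormedAddCommGroup H] [InnerProductSpace ℝ H]
    {z : ℕ → H} {w : H} {a μ : ℕ → ℝ} {amax σ δ G : ℝ} (hmono : Monotone a) (ha0 : a 0 = 0)
    (ha : ∀ k, a k ≤ amax) (hamax : amax < 1) (hμ : ∀ k, 0 < μ k) (hσ : 0 < σ) (hδ : 0 < δ)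
    (hG : G = amax * (1 + amax) + amax * δ)
    (hμle : ∀ k, μ k * (δ * (1 + (G + σ))) ≤ δ - amax * (G + σ))
    (hfej : ∀ k, ‖z (k + 2) - w‖ ^ 2
      ≤ ‖z (k + 1) + a k • (z (k + 1) - z k) - w‖ ^ 2
        - (1 - μ k) / μ k * ‖z (k + 2) - (z (k + 1) + a k • (z (k + 1) - z k))‖ ^ 2) :
    (∃ M, ∀ k, ‖z k - w‖ ≤ M) ∧ (∃ l, Tendsto (fun k => ‖z k - w‖ ^ 2) atTop (𝓝 l)) ∧
      Tendsto (fun k => z (k + 1) - z k) atTop (𝓝 0) := by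
  have hann : ∀ k, 0 ≤ a k := fun k => ha0 ▸ hmono (Nat.zero_le k)
  have hamax0 : 0 ≤ amax := (hann 0).trans (ha 0)
  have hG0 : 0 ≤ G := by rw [hG]; positivity
  set φ : ℕ → ℝ := fun k => ‖z k - w‖ ^ 2 with hφ
  have hφ0 : ∀ k, 0 ≤ φ k := fun k => sq_nonneg _
  set D : ℕ → ℝ := fun k => ‖z (k + 1) - z k‖ ^ 2 with hD
  have hD0 : ∀ k, 0 ≤ D k := fun k => sq_nonneg _
  have hstep : ∀ k, φ (k + 2) ≤ (1 + a k) * φ (k + 1) - a k * φ k + G * D k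
      - (G + σ) * D (k + 1) := fun k =>
    inertial_step (hann k) (ha k) (hμ k) hσ hδ hG (hμle k) (hfej k)
  set Ψ : ℕ → ℝ := fun k => φ (k + 1) - a k * φ k + G * D k with hΨ
  have hdec : ∀ k, σ * D (k + 1) ≤ Ψ k - Ψ (k + 1) := by
    intro k
    have h1 := hstep k
    have h2 := mul_le_mul_of_nonneg_right (hmono (Nat.le_succ k)) (hφ0 (k + 1))
    simp only [hΨ, Nat.succ_eq_add_one] at h2 ⊢
    linarith
  have hanti : Antitone Ψ := antitone_nat_of_succ_le fun k => by
    have := hdec k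
    have := mul_nonneg hσ.le (hD0 (k + 1))
    linarith
  have hφstep : ∀ k, φ (k + 1) ≤ amax * φ k + Ψ 0 := by
    intro k
    have h1 : Ψ k ≤ Ψ 0 := hanti (Nat.zero_le k)
    have h2 := mul_le_mul_of_nonneg_right (ha k) (hφ0 k)
    have h3 := mul_nonneg hG0 (hD0 k)
    simp only [hΨ] at h1 ⊢
    linarith
  set M := max (φ 0) (Ψ 0 / (1 - amax)) with hM
  have hφM : ∀ k, φ k ≤ M := by
    intro k
    induction k with
    | zero => exact le_max_left _ _
    | succ k ih =>
      have h1 := hφstep k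
      have h2 := mul_le_mul_of_nonneg_left ih hamax0
      have h3 : Ψ 0 ≤ M * (1 - amax) := (div_le_iff₀ (by linarith)).1 (le_max_right _ _)
      linarith
  have hbdd : BddBelow (Set.range Ψ) := by
    refine ⟨-M, ?_⟩
    rintro _ ⟨k, rfl⟩
    have h1 : a k * φ k ≤ 1 * M :=
      mul_le_mul ((ha k).trans hamax.le) (hφM k) (hφ0 k) zero_le_one
    have h2 := mul_nonneg hG0 (hD0 k)
    have h3 := hφ0 (k + 1)
    simp only [hΨ]
    linarith
  have hΨlim := tendsto_atTop_ciInf hanti hbdd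
  set L := ⨅ k, Ψ k
  have hDlim : Tendsto D atTop (𝓝 0) := by
    rw [← tendsto_add_atTop_iff_nat 1]
    have h1 : Tendsto (fun k => (Ψ k - Ψ (k + 1)) / σ) atTop (𝓝 0) := by
      have := (hΨlim.sub (hΨlim.comp (tendsto_add_atTop_nat 1))).div_const σ
      simpa using this
    refine squeeze_zero (fun k => hD0 _) (fun k => ?_) h1
    rw [le_div_iff₀ hσ, mul_comm]
    exact hdec k
  have hM0 : 0 ≤ M := (hφ0 0).trans (hφM 0)
  have hnormM : ∀ k, ‖z k - w‖ ≤ √M := fun k => Real.le_sqrt_of_sq_le (hφM k)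
  have hincr : Tendsto (fun k => ‖z (k + 1) - z k‖) atTop (𝓝 0) := by
    have := (Real.continuous_sqrt.tendsto 0).comp hDlim
    simpa [hD, Function.comp_def, Real.sqrt_sq] using this
  refine ⟨⟨√M, hnormM⟩, ?_, tendsto_zero_iff_norm_tendsto_zero.2 hincr⟩
  -- since the increments vanish, `φ (k + 1) - φ k → 0`, so `(1 - a k) φ k` converges with `Ψ k`
  have hdiff : Tendsto (fun k => φ (k + 1) - φ k) atTop (𝓝 0) := by
    have h1 : Tendsto (fun k => ‖z (k + 1) - z k‖ * (2 * √M)) atTop (𝓝 0) := by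
      simpa using hincr.mul_const (2 * √M)
    refine squeeze_zero_norm (fun k => ?_) h1
    have h2 : φ (k + 1) - φ k
        = (‖z (k + 1) - w‖ - ‖z k - w‖) * (‖z (k + 1) - w‖ + ‖z k - w‖) := by
      simp only [hφ]; ring
    rw [h2, norm_mul, Real.norm_eq_abs, Real.norm_eq_abs]
    have h3 : |‖z (k + 1) - w‖ - ‖z k - w‖| ≤ ‖z (k + 1) - z k‖ := by
      simpa using abs_norm_sub_norm_le (z (k + 1) - w) (z k - w)
    have h4 : |‖z (k + 1) - w‖ + ‖z k - w‖| ≤ 2 * √M := by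
      rw [abs_of_nonneg (by positivity)]
      linarith [hnormM k, hnormM (k + 1)]
    exact mul_le_mul h3 h4 (abs_nonneg _) (norm_nonneg _)
  have halim := tendsto_atTop_ciSup hmono ⟨amax, by rintro _ ⟨k, rfl⟩; exact ha k⟩
  have hb : (⨆ k, a k) < 1 := (ciSup_le ha).trans_lt hamax
  set b := ⨆ k, a k
  have h1 : Tendsto (fun k => (Ψ k - (φ (k + 1) - φ k) - G * D k) / (1 - a k)) atTop
      (𝓝 ((L - 0 - G * 0) / (1 - b))) :=
    ((hΨlim.sub hdiff).sub (hDlim.const_mul G)).div (tendsto_const_nhds.sub halim)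
      (by linarith)
  refine ⟨_, h1.congr fun k => ?_⟩
  have h2 : 1 - a k ≠ 0 := by linarith [ha k]
  rw [div_eq_iff h2]
  simp only [hΨ]
  ring

/-! ### Fixed points of the Davis–Yin operator and zeros of `A + B + C` -/

/-- The backward step on `A` of the Davis–Yin operator, `J_{γA} (2 J_{γB} - I - γ C J_{γB})`. -/
noncomputable def SetOp.davisYinA {H : Type*} [NormedAddCommGroup H] [InnerProductSpace ℝ H]
    (γ : ℝ) (A B : H → Set H) (C : H → H) (y : H) : H :=
  resolventMap γ A ((2 : ℝ) • resolventMap γ B y - y - γ • C (resolventMap γ B y))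

/-- The element of `A (davisYinA γ A B C y)` that the backward step on `A` selects. -/
noncomputable def SetOp.davisYinSelA {H : Type*} [NormedAddCommGroup H] [InnerProductSpace ℝ H]
    (γ : ℝ) (A B : H → Set H) (C : H → H) (y : H) : H :=
  γ⁻¹ • ((2 : ℝ) • resolventMap γ B y - y - γ • C (resolventMap γ B y) - davisYinA γ A B C y)

theorem isFixedPt_davisYin_iff {H : Type*} [NormedAddCommGroup H] [InnerProductSpace ℝ H]
    {γ : ℝ} {A B : H → Set H} {C : H → H} {w : H} :
    Function.IsFixedPt (davisYin γ A B C) w ↔ davisYinA γ A B C w = resolventMap γ B w := by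
  unfold Function.IsFixedPt davisYin davisYinA
  rw [sub_add, sub_eq_self, sub_eq_zero, eq_comm]

theorem davisYinSelA_mem {H : Type*} [NormedAddCommGroup H] [InnerProductSpace ℝ H]
    [CompleteSpace H] {γ : ℝ} (hγ : 0 < γ) {A : H → Set H} (hA : IsMaximallyMonotone A)
    (B : H → Set H) (C : H → H) (y : H) :
    davisYinSelA γ A B C y ∈ A (davisYinA γ A B C y) :=
  hA.resolvent_spec hγ _

/-- The selections from `A` and `B` at `y` add up to `-C J_{γB} y`, up to the residual. -/
theorem davisYinSelA_add {H : Type*} [NormedAddCommGroup H] [InnerProductSpace ℝ H]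
    {γ : ℝ} (hγ : 0 < γ) (A B : H → Set H) (C : H → H) (y : H) :
    davisYinSelA γ A B C y + γ⁻¹ • (y - resolventMap γ B y)
      = -(γ⁻¹ • (davisYinA γ A B C y - resolventMap γ B y)) - C (resolventMap γ B y) := by
  unfold davisYinSelA
  rw [← smul_add, ← smul_neg]
  have h : C (resolventMap γ B y) = γ⁻¹ • γ • C (resolventMap γ B y) :=
    (inv_smul_smul₀ hγ.ne' _).symm
  conv_rhs => rw [h]
  rw [← smul_sub]
  congr 1
  rw [two_smul]
  abel

/-- At a fixed point `w` the two selections lie in `A` and `B` at the common point `J_{γB} w`. -/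
theorem davisYinSelA_mem_of_isFixedPt {H : Type*} [NormedAddCommGroup H] [InnerProductSpace ℝ H]
    [CompleteSpace H] {γ : ℝ} (hγ : 0 < γ) {A : H → Set H} (hA : IsMaximallyMonotone A)
    {B : H → Set H} {C : H → H} {w : H} (hw : Function.IsFixedPt (davisYin γ A B C) w) :
    davisYinSelA γ A B C w ∈ A (resolventMap γ B w) := by
  have h := davisYinSelA_mem hγ hA B C w
  rwa [isFixedPt_davisYin_iff.1 hw] at h

theorem mem_zer_add_iff {H : Type*} [NormedAddCommGroup H] [InnerProductSpace ℝ H]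
    {A B : H → Set H} {C : H → H} {x : H} :
    x ∈ zer (A + B + ofFun C) ↔ ∃ u ∈ A x, ∃ v ∈ B x, u + v + C x = 0 := by
  simp only [zer, ofFun, Set.mem_ofPred_eq, Pi.add_apply, Set.mem_add, Set.mem_singleton_iff]
  constructor
  · rintro ⟨_, ⟨u, hu, v, hv, rfl⟩, _, rfl, h⟩
    exact ⟨u, hu, v, hv, h⟩
  · rintro ⟨u, hu, v, hv, h⟩
    exact ⟨_, ⟨u, hu, v, hv, rfl⟩, _, rfl, h⟩

theorem resolventMap_mem_zer_of_isFixedPt {H : Type*} [NormedAddCommGroup H]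
    [InnerProductSpace ℝ H] [CompleteSpace H] {γ : ℝ} (hγ : 0 < γ) {A B : H → Set H}
    (hA : IsMaximallyMonotone A) (hB : IsMaximallyMonotone B) {C : H → H} {w : H}
    (hw : Function.IsFixedPt (davisYin γ A B C) w) :
    resolventMap γ B w ∈ zer (A + B + ofFun C) := by
  refine mem_zer_add_iff.2 ⟨_, davisYinSelA_mem_of_isFixedPt hγ hA hw, _,
    hB.resolvent_spec hγ w, ?_⟩
  rw [davisYinSelA_add hγ, isFixedPt_davisYin_iff.1 hw]
  simp

theorem exists_isFixedPt_davisYin {H : Type*} [NormedAddCommGroup H]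
    [InnerProductSpace ℝ H] {γ : ℝ} (hγ : 0 < γ) {A B : H → Set H}
    (hA : IsMonotone A) (hB : IsMonotone B) {C : H → H}
    (hzer : (zer (A + B + ofFun C)).Nonempty) :
    ∃ w, Function.IsFixedPt (davisYin γ A B C) w := by
  obtain ⟨x, hx⟩ := hzer
  obtain ⟨u, hu, v, hv, huv⟩ := mem_zer_add_iff.1 hx
  have hJB : resolventMap γ B (x + γ • v) = x :=
    resolventMap_eq_of_mem hB hγ (by simpa [inv_smul_smul₀ hγ.ne'] using hv)
  refine ⟨x + γ • v, isFixedPt_davisYin_iff.2 ?_⟩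
  unfold davisYinA
  rw [hJB]
  refine resolventMap_eq_of_mem hA hγ ?_
  have h1 : (2 : ℝ) • x - (x + γ • v) - γ • C x - x = γ • u := by
    have hu' : u = -v - C x := by
      rw [← sub_eq_zero, ← huv]; abel
    rw [hu', smul_sub, smul_neg, two_smul]
    abel
  rwa [h1, inv_smul_smul₀ hγ.ne']

/-! ### The basic inequality -/

/-- The monotonicity gaps of `A`, `B` and `C` between a point `y` and a fixed point `w`, expressed
by the residual `d = davisYinA y - J_{γB} y`. -/
theorem gap_identity {H : Type*} [NormedAddCommGroup H] [InnerProductSpace ℝ H]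
    {γ : ℝ} (hγ : 0 < γ) {A B : H → Set H} {C : H → H} {w : H}
    (hw : Function.IsFixedPt (davisYin γ A B C) w) (y : H) :
    γ * (inner ℝ (davisYinA γ A B C y - resolventMap γ B w)
          (davisYinSelA γ A B C y - davisYinSelA γ A B C w)
        + inner ℝ (resolventMap γ B y - resolventMap γ B w)
          (γ⁻¹ • (y - resolventMap γ B y) - γ⁻¹ • (w - resolventMap γ B w))
        + inner ℝ (resolventMap γ B y - resolventMap γ B w)
          (C (resolventMap γ B y) - C (resolventMap γ B w)))
      = -inner ℝ (davisYinA γ A B C y - resolventMap γ B y) (y - w)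
        - ‖davisYinA γ A B C y - resolventMap γ B y‖ ^ 2
        - γ * inner ℝ (davisYinA γ A B C y - resolventMap γ B y)
          (C (resolventMap γ B y) - C (resolventMap γ B w)) := by
  have hfix := isFixedPt_davisYin_iff.1 hw
  unfold davisYinSelA
  rw [hfix]
  set x := resolventMap γ B y
  set p := resolventMap γ B w
  obtain ⟨d, hd⟩ : ∃ d, davisYinA γ A B C y = x + d := ⟨_, (add_sub_cancel _ _).symm⟩
  obtain ⟨f, hf⟩ : ∃ f, x - p = f := ⟨_, rfl⟩
  obtain ⟨e, he⟩ : ∃ e, y - w = e := ⟨_, rfl⟩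
  obtain ⟨g, hg⟩ : ∃ g, C x - C p = g := ⟨_, rfl⟩
  have h1 : x + d - p = f + d := by rw [← hf]; abel
  have h2 : (2 : ℝ) • x - y - γ • C x - (x + d) - ((2 : ℝ) • p - w - γ • C p - p)
      = f - e - γ • g - d := by
    rw [← hf, ← he, ← hg, smul_sub, two_smul, two_smul]; abel
  have h3 : y - x - (w - p) = e - f := by rw [← hf, ← he]; abel
  rw [hd, ← smul_sub, ← smul_sub, h1, h2, h3, hf, he, hg, add_sub_cancel_left,
    real_inner_smul_right, real_inner_smul_right, mul_add, mul_add, mul_inv_cancel_left₀ hγ.ne',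
    mul_inv_cancel_left₀ hγ.ne']
  simp only [inner_add_left, inner_sub_right, real_inner_smul_right, real_inner_self_eq_norm_sq]
  rw [real_inner_comm d f]
  ring

/-- The strong quasi-nonexpansiveness of the Davis–Yin operator at its fixed points. -/
theorem residual_inner_le {H : Type*} [NormedAddCommGroup H] [InnerProductSpace ℝ H]
    [CompleteSpace H] {γ β ε : ℝ} (hγ : 0 < γ) {A B : H → Set H} (hA : IsMaximallyMonotone A)
    (hB : IsMaximallyMonotone B) {C : H → H} (hβ : 0 < β) (hC : IsCocoercive β C)
    (hγε : γ ≤ 2 * β * ε) {w : H}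
    (hw : Function.IsFixedPt (davisYin γ A B C) w) (y : H) :
    (1 - ε / 2) * ‖davisYinA γ A B C y - resolventMap γ B y‖ ^ 2
      ≤ -inner ℝ (davisYinA γ A B C y - resolventMap γ B y) (y - w) := by
  have hid := gap_identity hγ hw y
  have hSA := hA.1 _ _ _ _ (davisYinSelA_mem hγ hA B C y) (davisYinSelA_mem_of_isFixedPt hγ hA hw)
  have hSB := hB.1 _ _ _ _ (hB.resolvent_spec hγ y) (hB.resolvent_spec hγ w)
  have hSC := hC (resolventMap γ B y) (resolventMap γ B w)
  set d := davisYinA γ A B C y - resolventMap γ B y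
  set g := C (resolventMap γ B y) - C (resolventMap γ B w)
  have h1 : 0 ≤ ‖d + (2 * β) • g‖ ^ 2 := sq_nonneg _
  rw [norm_add_sq_real, norm_smul, mul_pow, real_inner_smul_right, Real.norm_eq_abs, sq_abs] at h1
  have h2 : -(γ * inner ℝ d g) ≤ ε / 2 * ‖d‖ ^ 2 + γ * (β * ‖g‖ ^ 2) := by
    have h3 : -inner ℝ d g ≤ ‖d‖ ^ 2 / (4 * β) + β * ‖g‖ ^ 2 := by
      rw [div_add' _ _ _ (by positivity), le_div_iff₀ (by positivity)]
      linarith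
    have h4 := mul_le_mul_of_nonneg_left h3 hγ.le
    have h5 : γ * (‖d‖ ^ 2 / (4 * β)) ≤ ε / 2 * ‖d‖ ^ 2 := by
      rw [mul_div_assoc', div_le_iff₀ (by positivity)]
      have := mul_le_mul_of_nonneg_right hγε (sq_nonneg ‖d‖)
      linarith
    linarith
  have h6 := mul_le_mul_of_nonneg_left (add_le_add (add_nonneg hSA hSB) hSC) hγ.le
  rw [hid] at h6
  linarith

/-- The Fejér inequality for a relaxed step of length `lam` from `y`, with `μ = lam / (2 - ε)` the
relaxation relative to the underlying nonexpansive operator. -/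
theorem relaxed_step_fejer {H : Type*} [NormedAddCommGroup H] [InnerProductSpace ℝ H]
    {d y w : H} {lam ε : ℝ} (hlam : 0 < lam) (hε : ε < 2)
    (h : (1 - ε / 2) * ‖d‖ ^ 2 ≤ -inner ℝ d (y - w)) :
    ‖y + lam • d - w‖ ^ 2 ≤ ‖y - w‖ ^ 2
      - (1 - 1 / (2 - ε) * lam) / (1 / (2 - ε) * lam) * ‖y + lam • d - y‖ ^ 2 := by
  have h0 : 0 < 2 - ε := by linarith
  have h1 : y + lam • d - w = (y - w) + lam • d := by abel
  have h2 : (1 - 1 / (2 - ε) * lam) / (1 / (2 - ε) * lam) * (lam ^ 2 * ‖d‖ ^ 2)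
      = ((2 - ε) * lam - lam ^ 2) * ‖d‖ ^ 2 := by
    field_simp
  rw [h1, add_sub_cancel_left, norm_add_sq_real, norm_smul, mul_pow, Real.norm_eq_abs, sq_abs, h2,
    real_inner_smul_right, real_inner_comm d]
  have := mul_le_mul_of_nonneg_left h hlam.le
  linarith

/-! ### Asymptotics along a sequence with vanishing residual -/

/-- Along a bounded sequence with vanishing residual, the monotonicity gaps of `A` and `B` vanish
and the values of `C` converge strongly. -/
theorem gaps_tendsto_zero {H : Type*} [NormedAddCommGroup H] [InnerProductSpace ℝ H]
    [CompleteSpace H] {γ β : ℝ} (hγ : 0 < γ) {A B : H → Set H} (hA : IsMaximallyMonotone A)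
    (hB : IsMaximallyMonotone B) {C : H → H} (hβ : 0 < β) (hC : IsCocoercive β C) {w : H}
    (hw : Function.IsFixedPt (davisYin γ A B C) w) {y : ℕ → H} {M : ℝ} (hM : ∀ k, ‖y k - w‖ ≤ M)
    (hd : Tendsto (fun k => davisYinA γ A B C (y k) - resolventMap γ B (y k)) atTop (𝓝 0)) :
    Tendsto (fun k => inner ℝ (davisYinA γ A B C (y k) - resolventMap γ B w)
      (davisYinSelA γ A B C (y k) - davisYinSelA γ A B C w)) atTop (𝓝 0) ∧
    Tendsto (fun k => inner ℝ (resolventMap γ B (y k) - resolventMap γ B w)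
      (γ⁻¹ • (y k - resolventMap γ B (y k)) - γ⁻¹ • (w - resolventMap γ B w))) atTop (𝓝 0) ∧
    Tendsto (fun k => C (resolventMap γ B (y k))) atTop (𝓝 (C (resolventMap γ B w))) := by
  have hSA : ∀ k, _ := fun k => hA.1 _ _ _ _ (davisYinSelA_mem hγ hA B C (y k))
    (davisYinSelA_mem_of_isFixedPt hγ hA hw)
  have hSB : ∀ k, _ := fun k => hB.1 _ _ _ _ (hB.resolvent_spec hγ (y k)) (hB.resolvent_spec hγ w)
  have hSC : ∀ k, _ := fun k => hC (resolventMap γ B (y k)) (resolventMap γ B w)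
  have hSC0 : ∀ k, 0 ≤ inner ℝ (resolventMap γ B (y k) - resolventMap γ B w)
      (C (resolventMap γ B (y k)) - C (resolventMap γ B w)) := fun k =>
    (mul_nonneg hβ.le (sq_nonneg _)).trans (hSC k)
  -- `C` is Lipschitz, so the values of `C` along the sequence stay bounded
  have hCb : ∀ k, ‖C (resolventMap γ B (y k)) - C (resolventMap γ B w)‖ ≤ M / β := by
    intro k
    rw [le_div_iff₀ hβ]
    have h1 := (norm_resolventMap_sub_le hB hγ (y k) w).trans (hM k)
    have h2 := (hSC k).trans (real_inner_le_norm _ _)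
    by_contra! hlt
    have h3 := norm_nonneg (resolventMap γ B (y k) - resolventMap γ B w)
    have h4 := norm_nonneg (C (resolventMap γ B (y k)) - C (resolventMap γ B w))
    nlinarith
  have hn := hd.norm
  rw [norm_zero] at hn
  have hsum : Tendsto (fun k => γ⁻¹ * (‖davisYinA γ A B C (y k) - resolventMap γ B (y k)‖
      * (M + γ * (M / β)))) atTop (𝓝 0) := by
    simpa using (hn.mul_const (M + γ * (M / β))).const_mul γ⁻¹
  have hle : ∀ k, inner ℝ (davisYinA γ A B C (y k) - resolventMap γ B w)
          (davisYinSelA γ A B C (y k) - davisYinSelA γ A B C w)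
        + inner ℝ (resolventMap γ B (y k) - resolventMap γ B w)
          (γ⁻¹ • (y k - resolventMap γ B (y k)) - γ⁻¹ • (w - resolventMap γ B w))
        + inner ℝ (resolventMap γ B (y k) - resolventMap γ B w)
          (C (resolventMap γ B (y k)) - C (resolventMap γ B w))
      ≤ γ⁻¹ * (‖davisYinA γ A B C (y k) - resolventMap γ B (y k)‖ * (M + γ * (M / β))) := by
    intro k
    rw [le_inv_mul_iff₀ hγ, gap_identity hγ hw]
    set d := davisYinA γ A B C (y k) - resolventMap γ B (y k)
    have h1 := (abs_le.1 (abs_real_inner_le_norm d (y k - w))).1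
    have h2 := (abs_le.1 (abs_real_inner_le_norm d
      (C (resolventMap γ B (y k)) - C (resolventMap γ B w)))).1
    have h3 := mul_le_mul_of_nonneg_left (hM k) (norm_nonneg d)
    have h4 := mul_le_mul_of_nonneg_left (hCb k) (norm_nonneg d)
    have h5 := mul_le_mul_of_nonneg_left (h4.trans' (neg_le.1 h2)) hγ.le
    have h6 := sq_nonneg ‖d‖
    linarith
  refine ⟨squeeze_zero hSA (fun k => ?_) hsum, squeeze_zero hSB (fun k => ?_) hsum, ?_⟩
  · linarith [hle k, hSB k, hSC0 k]
  · linarith [hle k, hSA k, hSC0 k]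
  · have h1 : Tendsto (fun k => ‖C (resolventMap γ B (y k)) - C (resolventMap γ B w)‖ ^ 2) atTop
        (𝓝 0) := by
      have h2 := hsum.div_const β
      rw [zero_div] at h2
      refine squeeze_zero (fun k => sq_nonneg _) (fun k => ?_) h2
      rw [le_div_iff₀ hβ]
      linarith [hle k, hSA k, hSB k, hSC k]
    have h2 := (Real.continuous_sqrt.tendsto 0).comp h1
    rw [tendsto_iff_norm_sub_tendsto_zero]
    simpa [Function.comp_def, Real.sqrt_sq] using h2

/-- Vanishing monotonicity gaps force strong convergence for an operator that is uniformly
monotone on bounded sets. -/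
theorem tendsto_of_uniformlyMonotone {H : Type*} [NormedAddCommGroup H] [InnerProductSpace ℝ H]
    {A : H → Set H} (hA : IsUniformlyMonotoneOnBounded A) {x u : ℕ → H} {p v : H} {M : ℝ}
    (hu : ∀ k, u k ∈ A (x k)) (hv : v ∈ A p) (hM : ∀ k, ‖x k - p‖ ≤ M)
    (hgap : Tendsto (fun k => inner ℝ (x k - p) (u k - v)) atTop (𝓝 0)) :
    Tendsto x atTop (𝓝 p) := by
  have hbd : Bornology.IsBounded (insert p (Set.range x)) := by
    refine Bornology.isBounded_insert.2 ((Metric.isBounded_closedBall (x := p) (r := M)).subset ?_)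
    rintro _ ⟨k, rfl⟩
    rw [Metric.mem_closedBall, dist_eq_norm]
    exact hM k
  obtain ⟨ψ, hψmono, hψ0, hψ⟩ := hA (insert p (Set.range x))
    (Set.insert_subset ⟨v, hv⟩ (by rintro _ ⟨k, rfl⟩; exact ⟨_, hu k⟩))
    (Set.insert_nonempty _ _) hbd
  rw [Metric.tendsto_atTop']
  intro r hr
  lift r to ℝ≥0 using hr.le
  have hψr : (0 : EReal) < ((ψ r : ℝ≥0∞) : EReal) := by
    rw [EReal.coe_ennreal_pos, pos_iff_ne_zero, Ne, hψ0]
    exact (NNReal.coe_pos.1 hr).ne'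
  have hgap' : Tendsto (fun k => ((inner ℝ (x k - p) (u k - v) : ℝ) : EReal)) atTop
      (𝓝 ((0 : ℝ) : EReal)) := (continuous_coe_real_ereal.tendsto 0).comp hgap
  obtain ⟨N, hN⟩ := eventually_atTop.1 (hgap'.eventually_lt_const hψr)
  refine ⟨N, fun k hk => ?_⟩
  by_contra! hle
  rw [dist_eq_norm] at hle
  have h1 : ψ r ≤ ψ ‖x k - p‖₊ := hψmono hle
  have h2 := hψ (x k) (Or.inr ⟨k, rfl⟩) p (Or.inl rfl) (u k) (hu k) v hv
  exact absurd (hN k hk.le) (not_lt.2 ((EReal.coe_ennreal_le_coe_ennreal_iff.2 h1).trans h2))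

/-- The case of a base point `(x, x)` in the maximality of the product operator `A × B`: if
`((x, x), (u, v))` is monotonically related to the graph of `A × B`, it lies in that graph. -/
theorem mem_and_mem_of_forall_add {H : Type*} [NormedAddCommGroup H] [InnerProductSpace ℝ H]
    {A B : H → Set H} (hA : IsMaximallyMonotone A) (hB : IsMaximallyMonotone B) {x u v : H}
    (h : ∀ a a' b b', a' ∈ A a → b' ∈ B b →
      0 ≤ inner ℝ (x - a) (u - a') + inner ℝ (x - b) (v - b')) : u ∈ A x ∧ v ∈ B x := by
  have hAx : u ∈ A x := by
    refine hA.mem_of_forall fun a a' ha => ?_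
    by_contra! hlt
    have hBx : v ∈ B x := hB.mem_of_forall fun b b' hb => by
      linarith [h a a' b b' ha hb]
    have := h a a' x v ha hBx
    rw [sub_self x, inner_zero_left] at this
    linarith
  refine ⟨hAx, hB.mem_of_forall fun b b' hb => ?_⟩
  have := h x u b b' hAx hb
  rwa [sub_self x, inner_zero_left, zero_add] at this

/-- A demiclosedness principle for the pair `(A, B)`: weak limits of graph points of `A` and `B`
lie in the graphs if the base points get close and the sum of the values converges strongly. -/
theorem mem_and_mem_of_weak_limits {H : Type*} [NormedAddCommGroup H] [InnerProductSpace ℝ H]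
    {A B : H → Set H} (hA : IsMaximallyMonotone A) (hB : IsMaximallyMonotone B)
    {U : Ultrafilter ℕ} {xA xB uA uB : ℕ → H} {x u v : H} {M : ℝ}
    (huA : ∀ k, uA k ∈ A (xA k)) (huB : ∀ k, uB k ∈ B (xB k))
    (hMx : ∀ k, ‖xB k‖ ≤ M) (hMu : ∀ k, ‖uA k‖ ≤ M)
    (hx : ∀ c, Tendsto (fun k => inner ℝ c (xB k)) U (𝓝 (inner ℝ c x)))
    (hu : ∀ c, Tendsto (fun k => inner ℝ c (uA k)) U (𝓝 (inner ℝ c u)))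
    (hd : Tendsto (fun k => xA k - xB k) U (𝓝 0))
    (hs : Tendsto (fun k => uA k + uB k) U (𝓝 (u + v))) : u ∈ A x ∧ v ∈ B x := by
  refine mem_and_mem_of_forall_add hA hB fun a a' b b' ha hb => ?_
  have h1 := tendsto_inner_of_strong_weak hMu hd hu
  have h2 := tendsto_inner_of_strong_weak hMx hs hx
  have hd' : ∀ c : H, Tendsto (fun k => inner ℝ c (xA k - xB k)) U (𝓝 0) := fun c => by
    simpa using (tendsto_const_nhds (x := c)).inner hd
  have hs' : ∀ c : H, Tendsto (fun k => inner ℝ c (uA k + uB k)) U (𝓝 (inner ℝ c (u + v))) :=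
    fun c => (tendsto_const_nhds (x := c)).inner hs
  have hlim := (((((h1.add h2).sub (hu a)).sub ((hd' a').add (hx a'))).sub
    ((hs' b).sub (hu b))).sub (hx b')).add_const (inner ℝ a a' + inner ℝ b b')
  refine ge_of_tendsto_of_frequently (hlim.trans (le_of_eq (congrArg 𝓝 ?_)))
    (Eventually.frequently (Eventually.of_forall fun k => ?_))
  · simp only [inner_add_right, inner_sub_left, inner_sub_right, inner_zero_left,
      real_inner_comm x]
    ring
  · have h3 := hA.1 _ _ _ _ (huA k) ha
    have h4 := hB.1 _ _ _ _ (huB k) hb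
    refine (add_nonneg h3 h4).trans (le_of_eq ?_)
    simp only [inner_add_right, inner_sub_left, inner_sub_right, real_inner_comm (xA k),
      real_inner_comm (xB k)]
    ring

/-- A weak cluster point of a bounded sequence with vanishing residual is a fixed point of the
Davis–Yin operator, and along the same ultrafilter the resolvents of `B` converge weakly to its
resolvent, although `J_{γB}` is not weakly continuous. -/
theorem isFixedPt_of_weak_limit {H : Type*} [NormedAddCommGroup H] [InnerProductSpace ℝ H]
    [CompleteSpace H] {γ β : ℝ} (hγ : 0 < γ) {A B : H → Set H} (hA : IsMaximallyMonotone A)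
    (hB : IsMaximallyMonotone B) {C : H → H} (hβ : 0 < β) (hC : IsCocoercive β C) {w : H}
    (hw : Function.IsFixedPt (davisYin γ A B C) w) {y : ℕ → H} {M : ℝ} (hM : ∀ k, ‖y k - w‖ ≤ M)
    (hd : Tendsto (fun k => davisYinA γ A B C (y k) - resolventMap γ B (y k)) atTop (𝓝 0))
    {U : Ultrafilter ℕ} (hU : (U : Filter ℕ) ≤ atTop) {a : H}
    (hy : ∀ c, Tendsto (fun k => inner ℝ c (y k)) U (𝓝 (inner ℝ c a))) :
    Function.IsFixedPt (davisYin γ A B C) a ∧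
      ∀ c, Tendsto (fun k => inner ℝ c (resolventMap γ B (y k))) U
        (𝓝 (inner ℝ c (resolventMap γ B a))) := by
  obtain ⟨-, -, hClim⟩ := gaps_tendsto_zero hγ hA hB hβ hC hw hM hd
  have hdU := hd.mono_left hU
  have hCU := hClim.mono_left hU
  set xB : ℕ → H := fun k => resolventMap γ B (y k) with hxB
  set xA : ℕ → H := fun k => davisYinA γ A B C (y k) with hxA
  set uA : ℕ → H := fun k => davisYinSelA γ A B C (y k) with huA
  set uB : ℕ → H := fun k => γ⁻¹ • (y k - resolventMap γ B (y k)) with huB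
  set c₀ := C (resolventMap γ B w)
  have hsum : ∀ k, uA k + uB k = -(γ⁻¹ • (xA k - xB k)) - C (xB k) := fun k =>
    davisYinSelA_add hγ A B C (y k)
  have hMB : ∀ k, ‖xB k‖ ≤ M + ‖resolventMap γ B w‖ := fun k => by
    have h1 := (norm_resolventMap_sub_le hB hγ (y k) w).trans (hM k)
    have h2 := norm_le_norm_sub_add (xB k) (resolventMap γ B w)
    linarith
  obtain ⟨x, hx⟩ := exists_weak_limit_of_bounded U hMB
  -- the values of `C` converge strongly, so the limit is `C` of the weak limit
  have hCx : C x = c₀ := by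
    have h1 := tendsto_inner_of_strong_weak hMB (hCU.sub_const (C x)) hx
    have h2 : Tendsto (fun k => inner ℝ (C (xB k) - C x) x) U (𝓝 (inner ℝ (c₀ - C x) x)) :=
      (hCU.sub_const (C x)).inner tendsto_const_nhds
    have h3 : Tendsto (fun k => β * ‖C (xB k) - C x‖ ^ 2) U (𝓝 (β * ‖c₀ - C x‖ ^ 2)) :=
      ((hCU.sub_const (C x)).norm.pow 2).const_mul β
    have h4 := le_of_tendsto_of_tendsto' h3 (h1.sub h2) fun k => by
      rw [← inner_sub_right, real_inner_comm]
      exact hC (xB k) x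
    rw [sub_self] at h4
    have h5 : ‖c₀ - C x‖ ^ 2 = 0 :=
      le_antisymm (nonpos_of_mul_nonpos_right h4 hβ) (sq_nonneg _)
    exact (sub_eq_zero.1 (norm_eq_zero.1 (pow_eq_zero_iff two_ne_zero |>.1 h5))).symm
  have hs : Tendsto (fun k => uA k + uB k) U (𝓝 (-c₀)) := by
    have h := (hdU.const_smul γ⁻¹).neg.sub hCU
    simp only [smul_zero, neg_zero, zero_sub] at h
    exact h.congr fun k => (hsum k).symm
  have huBlim : ∀ c, Tendsto (fun k => inner ℝ c (uB k)) U (𝓝 (inner ℝ c (γ⁻¹ • (a - x)))) := by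
    intro c
    simp only [huB, real_inner_smul_right, inner_sub_right]
    exact ((hy c).sub (hx c)).const_mul γ⁻¹
  have huAlim : ∀ c, Tendsto (fun k => inner ℝ c (uA k)) U
      (𝓝 (inner ℝ c (-c₀ - γ⁻¹ • (a - x)))) := by
    intro c
    have h := ((tendsto_const_nhds (x := c)).inner hs).sub (huBlim c)
    rw [inner_sub_right]
    exact h.congr fun k => by rw [← inner_sub_right, add_sub_cancel_right]
  obtain ⟨M', hM'⟩ : ∃ M', ∀ k, ‖uA k‖ ≤ M' := by
    obtain ⟨Md, hMd⟩ := hd.norm.bddAbove_range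
    obtain ⟨Mc, hMc⟩ := hClim.norm.bddAbove_range
    refine ⟨γ⁻¹ * Md + Mc + γ⁻¹ * ((M + ‖w‖) + (M + ‖resolventMap γ B w‖)), fun k => ?_⟩
    have h1 : uA k = -(γ⁻¹ • (xA k - xB k)) - C (xB k) - uB k := by
      rw [← hsum, add_sub_cancel_right]
    have h2 : ‖xA k - xB k‖ ≤ Md := hMd ⟨k, rfl⟩
    have h3 : ‖C (xB k)‖ ≤ Mc := hMc ⟨k, rfl⟩
    have h4 : ‖y k‖ ≤ M + ‖w‖ := by
      linarith [norm_le_norm_sub_add (y k) w, hM k]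
    have hγ' : 0 ≤ γ⁻¹ := (inv_pos.2 hγ).le
    have h5 : ‖uB k‖ ≤ γ⁻¹ * ((M + ‖w‖) + (M + ‖resolventMap γ B w‖)) := by
      rw [huB, norm_smul, Real.norm_of_nonneg hγ']
      refine mul_le_mul_of_nonneg_left ?_ hγ'
      exact (norm_sub_le _ _).trans (add_le_add h4 (hMB k))
    rw [h1]
    refine (norm_sub_le _ _).trans (add_le_add ((norm_sub_le _ _).trans (add_le_add ?_ h3)) h5)
    rw [norm_neg, norm_smul, Real.norm_of_nonneg hγ']
    exact mul_le_mul_of_nonneg_left h2 hγ'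
  obtain ⟨hAx, hBx⟩ := mem_and_mem_of_weak_limits hA hB
    (M := max (M + ‖resolventMap γ B w‖) M') (v := γ⁻¹ • (a - x))
    (fun k => davisYinSelA_mem hγ hA B C (y k)) (fun k => hB.resolvent_spec hγ (y k))
    (fun k => (hMB k).trans (le_max_left _ _)) (fun k => (hM' k).trans (le_max_right _ _))
    hx huAlim hdU (by rwa [sub_add_cancel])
  have hJB : resolventMap γ B a = x := resolventMap_eq_of_mem hB.1 hγ hBx
  rw [hJB]
  refine ⟨isFixedPt_davisYin_iff.2 ?_, hx⟩
  unfold davisYinA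
  rw [hJB]
  refine resolventMap_eq_of_mem hA.1 hγ ?_
  have h1 : (2 : ℝ) • x - a - γ • C x - x = γ • (-c₀ - γ⁻¹ • (a - x)) := by
    rw [hCx, smul_sub, smul_inv_smul₀ hγ.ne', two_smul, smul_neg]
    abel
  rwa [h1, inv_smul_smul₀ hγ.ne']

/-- Opial's lemma: if the distances to all points of `F` converge and all weak cluster points lie
in `F`, the sequence converges weakly to a point of `F`. -/
theorem opial {H : Type*} [NormedAddCommGroup H] [InnerProductSpace ℝ H] [CompleteSpace H]
    {z : ℕ → H} {F : Set H} {M : ℝ} (hM : ∀ k, ‖z k‖ ≤ M)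
    (hdist : ∀ w ∈ F, ∃ l, Tendsto (fun k => ‖z k - w‖ ^ 2) atTop (𝓝 l))
    (hcl : ∀ U : Ultrafilter ℕ, (U : Filter ℕ) ≤ atTop → ∀ a,
      (∀ v, Tendsto (fun k => inner ℝ v (z k)) U (𝓝 (inner ℝ v a))) → a ∈ F) :
    ∃ a ∈ F, WeakTendsto z a := by
  have hU₀ : ((hyperfilter ℕ : Ultrafilter ℕ) : Filter ℕ) ≤ atTop := Nat.hyperfilter_le_atTop
  obtain ⟨a, ha⟩ := exists_weak_limit_of_bounded (hyperfilter ℕ) hM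
  have haF := hcl _ hU₀ a ha
  refine ⟨a, haF, weakTendsto_iff_forall_inner.2 fun v => ?_⟩
  rw [tendsto_iff_ultrafilter]
  intro U hU
  obtain ⟨b, hb⟩ := exists_weak_limit_of_bounded U hM
  obtain ⟨l, hl⟩ := hdist a haF
  obtain ⟨m, hm⟩ := hdist b (hcl U hU b hb)
  -- `⟪b - a, z k⟫` converges, so it has the same limit along both ultrafilters
  have hconv : Tendsto (fun k => inner ℝ (b - a) (z k)) atTop
      (𝓝 ((l - m - ‖a‖ ^ 2 + ‖b‖ ^ 2) / 2)) := by
    refine ((((hl.sub hm).sub_const (‖a‖ ^ 2)).add_const (‖b‖ ^ 2)).div_const 2).congr fun k => ?_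
    rw [norm_sub_sq_real, norm_sub_sq_real, inner_sub_left, real_inner_comm (z k) b,
      real_inner_comm (z k) a]
    ring
  have h1 := tendsto_nhds_unique (hb (b - a)) (hconv.mono_left hU)
  have h2 := tendsto_nhds_unique (ha (b - a)) (hconv.mono_left hU₀)
  have h3 : inner ℝ (b - a) (b - a) = 0 := by
    rw [inner_sub_right, h1, h2, sub_self]
  rw [inner_self_eq_zero, sub_eq_zero] at h3
  rw [← h3]
  exact hb v

/-! ### Convergence of the algorithm -/

theorem SetOp.WeakTendsto.of_add_one {H : Type*} [NormedAddCommGroup H] [InnerProductSpace ℝ H]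
    {x : ℕ → H} {a : H} (h : WeakTendsto (fun k => x (k + 1)) a) : WeakTendsto x a :=
  (tendsto_add_atTop_iff_nat (f := fun k => toWeakSpace ℝ H (x k)) 1).1 h

/-- Adding a sequence that tends to `0` in norm does not change a weak limit. -/
theorem SetOp.WeakTendsto.add_of_tendsto_zero {H : Type*} [NormedAddCommGroup H]
    [InnerProductSpace ℝ H] [CompleteSpace H] {x d : ℕ → H} {a : H}
    (h : WeakTendsto x a) (hd : Tendsto d atTop (𝓝 0)) :
    WeakTendsto (fun k => x k + d k) a := by
  refine weakTendsto_iff_forall_inner.2 fun v => ?_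
  have h1 := (weakTendsto_iff_forall_inner.1 h v).add ((tendsto_const_nhds (x := v)).inner hd)
  simpa only [inner_add_right, inner_zero_right, add_zero] using h1

theorem mainTheorem1 {H : Type*} [NormedAddCommGroup H] [InnerProductSpace ℝ H] [CompleteSpace H]
    (A B : H → Set H) (C : H → H) (β : ℝ)
    (hA : IsMaximallyMonotone A) (hB : IsMaximallyMonotone B)
    (hβ : 0 < β) (hC : IsCocoercive β C)
    (hzer : (zer (A + B + ofFun C)).Nonempty)
    (γ ε : ℝ) (hε : ε ∈ Set.Ioo (0 : ℝ) 1) (hγ : γ ∈ Set.Ioo 0 (2 * β * ε))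
    (α : ℕ → ℝ) (αmax : ℝ) (hα_mono : MonotoneOn α (Set.Ici 1)) (hα_one : α 1 = 0)
    (hα_bd : ∀ k, 1 ≤ k → 0 ≤ α k ∧ α k ≤ αmax) (hαmax : αmax < 1)
    (lam : ℕ → ℝ) (lmin σ δ : ℝ) (hlmin : 0 < lmin) (hσ : 0 < σ)
    (hδ_pos : 0 < δ)
    (hδ : (αmax ^ 2 * (1 + αmax) + αmax * σ) / (1 - αmax ^ 2) < δ)
    (hlam : ∀ k, 1 ≤ k → lmin ≤ lam k ∧
      lam k ≤ (δ - αmax * (αmax * (1 + αmax) + αmax * δ + σ)) /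
        ((1 / (2 - ε)) * δ * (1 + αmax * (1 + αmax) + αmax * δ + σ)))
    (zpre : H) (z y xB xA : ℕ → H)
    (halg : IsInertialSplitting γ A B C α lam zpre z y xB xA) :
    (∃ zs : H, Function.IsFixedPt (davisYin γ A B C) zs ∧
      WeakTendsto z zs ∧
      resolventMap γ B zs ∈ zer (A + B + ofFun C) ∧
      WeakTendsto xB (resolventMap γ B zs) ∧
      WeakTendsto xA (resolventMap γ B zs) ∧
      ((IsUniformlyMonotoneOnBounded A ∨ IsUniformlyMonotoneOnBounded B ∨
          ∀ x ∈ zer (A + B + ofFun C), IsDemiregularAt (ofFun C) x) →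
        Tendsto xA atTop (𝓝 (resolventMap γ B zs)) ∧ Tendsto xB atTop (𝓝 (resolventMap γ B zs)))) ∧
    (∀ w : H, Function.IsFixedPt (davisYin γ A B C) w →
      resolventMap γ B w ∈ zer (A + B + ofFun C) ∧
      ((IsUniformlyMonotoneOnBounded A ∨ IsUniformlyMonotoneOnBounded B) →
        Tendsto xA atTop (𝓝 (resolventMap γ B w)) ∧ Tendsto xB atTop (𝓝 (resolventMap γ B w)))) := by
  obtain ⟨hε0, hε1⟩ := hε
  obtain ⟨hγ0, hγε⟩ := hγ
  have hαmax0 : 0 ≤ αmax := hα_one ▸ (hα_bd 1 le_rfl).2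
  obtain ⟨G, hG⟩ : ∃ G, G = αmax * (1 + αmax) + αmax * δ := ⟨_, rfl⟩
  have hG0 : 0 ≤ G := by rw [hG]; positivity
  -- the iteration from index `1` on, where the conditions on `α` and `lam` hold
  have hy : ∀ k, y (k + 1) = z (k + 1) + α (k + 1) • (z (k + 1) - z k) := halg.y_succ
  have hxB : ∀ k, xB k = resolventMap γ B (y k) := halg.xB_eq
  have hxA : ∀ k, xA k = davisYinA γ A B C (y k) := fun k => by
    rw [halg.xA_eq, hxB]; rfl
  have hz : ∀ k, z (k + 2) = y (k + 1)
      + lam (k + 1) • (davisYinA γ A B C (y (k + 1)) - resolventMap γ B (y (k + 1))) := fun k => by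
    rw [halg.z_succ (k + 1), hxA, hxB]
  have hlam0 : ∀ k, 0 < lam (k + 1) := fun k =>
    hlmin.trans_le (hlam (k + 1) (Nat.le_add_left 1 k)).1
  have hμ0 : 0 < 1 / (2 - ε) := one_div_pos.2 (by linarith)
  have hμle : ∀ k, 1 / (2 - ε) * lam (k + 1) * (δ * (1 + (G + σ))) ≤ δ - αmax * (G + σ) := by
    intro k
    have h1 := (hlam (k + 1) (Nat.le_add_left 1 k)).2
    have hQ : αmax * (1 + αmax) + αmax * δ + σ = G + σ := by rw [hG]
    have hQ' : 1 + αmax * (1 + αmax) + αmax * δ + σ = 1 + (G + σ) := by rw [hG]; ring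
    rw [hQ, hQ', le_div_iff₀ (by positivity)] at h1
    linarith
  have hfej : ∀ w, Function.IsFixedPt (davisYin γ A B C) w →
      (∃ M, ∀ k, ‖z k - w‖ ≤ M) ∧ (∃ l, Tendsto (fun k => ‖z k - w‖ ^ 2) atTop (𝓝 l)) ∧
        Tendsto (fun k => z (k + 1) - z k) atTop (𝓝 0) := by
    intro w hw
    refine inertial_fejer_convergence (a := fun k => α (k + 1)) (σ := σ)
      (μ := fun k => 1 / (2 - ε) * lam (k + 1))
      (fun i j hij => hα_mono (Nat.le_add_left 1 i) (Nat.le_add_left 1 j) (by omega)) hα_one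
      (fun k => (hα_bd (k + 1) (Nat.le_add_left 1 k)).2) hαmax
      (fun k => mul_pos hμ0 (hlam0 k)) hσ hδ_pos hG hμle fun k => ?_
    have h := relaxed_step_fejer (hlam0 k) (by linarith : ε < 2)
      (residual_inner_le hγ0 hA hB hβ hC hγε.le hw (y (k + 1)))
    rw [← hz] at h
    simpa only [← hy] using h
  obtain ⟨w₀, hw₀⟩ := exists_isFixedPt_davisYin hγ0 hA.1 hB.1 hzer
  obtain ⟨⟨M₀, hM₀⟩, -, hincr⟩ := hfej w₀ hw₀
  have hα01 : ∀ k, ‖α (k + 1)‖ ≤ 1 := fun k => by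
    obtain ⟨h1, h2⟩ := hα_bd (k + 1) (Nat.le_add_left 1 k)
    rw [Real.norm_of_nonneg h1]
    linarith
  have hinert : Tendsto (fun k => α (k + 1) • (z (k + 1) - z k)) atTop (𝓝 0) := by
    refine squeeze_zero_norm (fun k => ?_) (tendsto_zero_iff_norm_tendsto_zero.1 hincr)
    rw [norm_smul]
    exact mul_le_of_le_one_left (norm_nonneg _) (hα01 k)
  have hd : Tendsto (fun k => davisYinA γ A B C (y (k + 1)) - resolventMap γ B (y (k + 1))) atTop
      (𝓝 0) := by
    have h1 : Tendsto (fun k => lmin⁻¹ *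
        ‖(z (k + 1 + 1) - z (k + 1)) - α (k + 1) • (z (k + 1) - z k)‖) atTop (𝓝 0) := by
      have := (((tendsto_add_atTop_iff_nat 1).2 hincr).sub hinert).norm.const_mul lmin⁻¹
      simpa using this
    refine squeeze_zero_norm (fun k => ?_) h1
    have h2 : (z (k + 1 + 1) - z (k + 1)) - α (k + 1) • (z (k + 1) - z k)
        = lam (k + 1) • (davisYinA γ A B C (y (k + 1)) - resolventMap γ B (y (k + 1))) := by
      rw [sub_sub, ← hy, hz, add_sub_cancel_left]
    rw [h2, norm_smul, Real.norm_of_nonneg (hlam0 k).le, le_inv_mul_iff₀ hlmin]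
    exact mul_le_mul_of_nonneg_right (hlam (k + 1) (Nat.le_add_left 1 k)).1 (norm_nonneg _)
  have hyM : ∀ w, Function.IsFixedPt (davisYin γ A B C) w → ∃ M, ∀ k, ‖y (k + 1) - w‖ ≤ M := by
    intro w hw
    obtain ⟨⟨M, hM⟩, -, -⟩ := hfej w hw
    refine ⟨3 * M, fun k => ?_⟩
    have h1 : y (k + 1) - w
        = (z (k + 1) - w) + α (k + 1) • ((z (k + 1) - w) - (z k - w)) := by
      rw [hy, sub_sub_sub_cancel_right]; abel
    have h2 : ‖α (k + 1) • ((z (k + 1) - w) - (z k - w))‖ ≤ M + M := by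
      rw [norm_smul]
      exact (mul_le_of_le_one_left (norm_nonneg _) (hα01 k)).trans
        ((norm_sub_le _ _).trans (add_le_add (hM _) (hM _)))
    rw [h1]
    linarith [norm_add_le (z (k + 1) - w) (α (k + 1) • ((z (k + 1) - w) - (z k - w))), hM (k + 1)]
  have hxBd : ∀ k, xA (k + 1) = xB (k + 1)
      + (davisYinA γ A B C (y (k + 1)) - resolventMap γ B (y (k + 1))) := fun k => by
    rw [hxA, hxB, add_sub_cancel]
  -- strong convergence of one of the two sequences `xA`, `xB` entails that of the other
  have hstrongB : ∀ p, Tendsto (fun k => xB (k + 1)) atTop (𝓝 p) →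
      Tendsto xA atTop (𝓝 p) ∧ Tendsto xB atTop (𝓝 p) := by
    intro p hp
    refine ⟨(tendsto_add_atTop_iff_nat 1).1 ?_, (tendsto_add_atTop_iff_nat 1).1 hp⟩
    simp only [hxBd]
    simpa using hp.add hd
  have hstrongA : ∀ p, Tendsto (fun k => xA (k + 1)) atTop (𝓝 p) →
      Tendsto xA atTop (𝓝 p) ∧ Tendsto xB atTop (𝓝 p) := by
    intro p hp
    refine hstrongB p ?_
    have h := hp.sub hd
    rw [sub_zero] at h
    exact h.congr fun k => by rw [hxBd, add_sub_cancel_right]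
  have hbdB : ∀ w M, (∀ k, ‖y (k + 1) - w‖ ≤ M) →
      ∀ k, ‖xB (k + 1) - resolventMap γ B w‖ ≤ M := fun w M hM k => by
    rw [hxB]
    exact (norm_resolventMap_sub_le hB hγ0 _ _).trans (hM k)
  have huniform : ∀ w, Function.IsFixedPt (davisYin γ A B C) w →
      (IsUniformlyMonotoneOnBounded A ∨ IsUniformlyMonotoneOnBounded B) →
      Tendsto xA atTop (𝓝 (resolventMap γ B w)) ∧ Tendsto xB atTop (𝓝 (resolventMap γ B w)) := by
    intro w hw hAB
    obtain ⟨M, hM⟩ := hyM w hw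
    obtain ⟨hgA, hgB, -⟩ := gaps_tendsto_zero hγ0 hA hB hβ hC hw hM hd
    rcases hAB with hUA | hUB
    · obtain ⟨R, hR⟩ := hd.norm.bddAbove_range
      refine hstrongA _ ?_
      simp only [hxA]
      refine tendsto_of_uniformlyMonotone hUA (M := M + R)
        (fun k => davisYinSelA_mem hγ0 hA B C (y (k + 1)))
        (davisYinSelA_mem_of_isFixedPt hγ0 hA hw) (fun k => ?_) hgA
      rw [← hxA, hxBd, add_sub_right_comm]
      exact (norm_add_le _ _).trans (add_le_add (hbdB w M hM k) (hR ⟨k, rfl⟩))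
    · refine hstrongB _ ?_
      simp only [hxB]
      refine tendsto_of_uniformlyMonotone hUB (M := M)
        (fun k => hB.resolvent_spec hγ0 (y (k + 1))) (hB.resolvent_spec hγ0 w) (fun k => ?_) hgB
      rw [← hxB]
      exact hbdB w M hM k
  have hzer_of : ∀ w, Function.IsFixedPt (davisYin γ A B C) w →
      resolventMap γ B w ∈ zer (A + B + ofFun C) := fun w hw =>
    resolventMap_mem_zer_of_isFixedPt hγ0 hA hB hw
  refine ⟨?_, fun w hw => ⟨hzer_of w hw, huniform w hw⟩⟩
  obtain ⟨M, hM⟩ := hyM w₀ hw₀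
  -- weak limits of `z` and of the extrapolated points agree along every ultrafilter
  have hyz : ∀ (l : Filter ℕ), l ≤ atTop → ∀ a : H,
      (∀ v, Tendsto (fun k => inner ℝ v (z (k + 1))) l (𝓝 (inner ℝ v a))) →
      ∀ v, Tendsto (fun k => inner ℝ v (y (k + 1))) l (𝓝 (inner ℝ v a)) := by
    intro l hl a ha v
    have h := (ha v).add ((tendsto_const_nhds (x := v)).inner (hinert.mono_left hl))
    simp only [hy, inner_add_right]
    simpa only [inner_zero_right, add_zero] using h
  obtain ⟨zs, hzs, hzw⟩ := opial (z := fun k => z (k + 1))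
    (F := {w | Function.IsFixedPt (davisYin γ A B C) w}) (M := M₀ + ‖w₀‖)
    (fun k => by linarith [norm_le_norm_sub_add (z (k + 1)) w₀, hM₀ (k + 1)])
    (fun w hw => by
      obtain ⟨-, ⟨l, hl⟩, -⟩ := hfej w hw
      exact ⟨l, (tendsto_add_atTop_iff_nat (f := fun k => ‖z k - w‖ ^ 2) 1).2 hl⟩)
    (fun U hU a ha =>
      (isFixedPt_of_weak_limit hγ0 hA hB hβ hC hw₀ hM hd hU (hyz U hU a ha)).1)
  have hxBw : WeakTendsto (fun k => xB (k + 1)) (resolventMap γ B zs) := by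
    refine weakTendsto_iff_forall_inner.2 fun v => ?_
    rw [tendsto_iff_ultrafilter]
    intro U hU
    simp only [hxB]
    exact (isFixedPt_of_weak_limit hγ0 hA hB hβ hC hw₀ hM hd hU (hyz U hU zs fun c =>
      (weakTendsto_iff_forall_inner.1 hzw c).mono_left hU)).2 v
  refine ⟨zs, hzs, hzw.of_add_one, hzer_of zs hzs, hxBw.of_add_one, ?_, ?_⟩
  · refine WeakTendsto.of_add_one ?_
    simp only [hxBd]
    exact hxBw.add_of_tendsto_zero hd
  · rintro (hUA | hUB | hdemi)
    · exact huniform zs hzs (Or.inl hUA)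
    · exact huniform zs hzs (Or.inr hUB)
    · obtain ⟨M', hM'⟩ := hyM zs hzs
      have hClim := (gaps_tendsto_zero hγ0 hA hB hβ hC hzs hM' hd).2.2
      refine hstrongB _ ((hdemi _ (hzer_of zs hzs)).2 (C (resolventMap γ B zs)) rfl
        (fun k => xB (k + 1)) (fun k => C (xB (k + 1))) (fun k => rfl) hxBw ?_)
      simpa only [hxB] using hClim
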